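/- Let $[\mathbb{N}]^{<\omega}$ be the set of finite subsets of $\mathbb{N}$, each listed in increasing order, with the tree metric $d_T(\bar m,\bar n)=|\bar m|+|\bar n|-2|\bar m\wedge\bar n|$, where $\bar m\wedge\bar n$ is the longest common initial segment of $\bar m$ and $\bar n$. The countably branching tree of infinite height is $T_\infty^\omega=([\mathbb{N}]^{<\omega},d_T)$, and the countably branching tree of height $k$, $T_k^\omega$, is its subspace of sets with at most $k$ elements. For a map $f\colon X\to Y$ between metric spaces and $t\ge 0$ put $$\rho_f(t)=\inf\{d_Y(f(x),f(y)) : d_X(x,y)\ge t\},\qquad \omega_f(t)=\sup\{d_Y(f(x),f(y)) : d_X(x,y)\le t\},$$ with $\inf\emptyset=\infty$ and $\sup\emptyset=0$. The map $f$ is a coarse embedding if $\lim_{t\to\infty}\rho_f(t)=\infty$ and $\omega_f(t)<\infty$ for all $t>0$; $X$ coarsely embeds into $Y$ if there is a coarse embedding $X\to Y$. A family $(X_i)_{i\in I}$ of metric spaces equi-coarsely embeds into $Y$ if there are non-decreasing functions $\rho,\omega\colon[0,\infty)\to[0,\infty)$ with $\lim_{t\to\infty}\rho(t)=\infty$ and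 maps $f_i\colon X_i\to Y$ such that $\rho\le\rho_{f_i}$ and $\omega_{f_i}\le\omega$ for all $i\in I$. Theorem. For a (real or complex) Banach space $Y$ the following assertions are equivalent: (1) $Y$ is finite dimensional; (2) $(T_k^\omega)_{k\ge1}$ does not equi-coarsely embed into $Y$; (3) $T_\infty^\omega$ does not coarsely embed into $Y$. -/

import Mathlib

open scoped NNReal ENNReal Topology
open Filter

namespace CoarseTree

section Moduli

variable {X Y : Type*} [PseudoMetricSpace X] [PseudoMetricSpace Y]

/-- The compression modulus `ρ_f(t) = inf {d(f x, f y) : d(x, y) ≥ t}`, with values in `[0, ∞]`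
and `inf ∅ = ∞`. -/
noncomputable def compressionModulus (f : X → Y) (t : ℝ≥0) : ℝ≥0∞ :=
  ⨅ (x : X) (y : X) (_ : t ≤ nndist x y), edist (f x) (f y)

/-- The expansion modulus `ω_f(t) = sup {d(f x, f y) : d(x, y) ≤ t}`, with values in `[0, ∞]`
and `sup ∅ = 0`. -/
noncomputable def expansionModulus (f : X → Y) (t : ℝ≥0) : ℝ≥0∞ :=
  ⨆ (x : X) (y : X) (_ : nndist x y ≤ t), edist (f x) (f y)

/-- `f` is a coarse embedding: `ρ_f(t) → ∞` as `t → ∞` and `ω_f(t) < ∞` for all `t > 0`. -/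
def IsCoarseEmbedding (f : X → Y) : Prop :=
  Tendsto (compressionModulus f) atTop (𝓝 ⊤) ∧ ∀ t : ℝ≥0, 0 < t → expansionModulus f t < ⊤

end Moduli

/-- `X` coarsely embeds into `Y`. -/
def CoarselyEmbeds (X Y : Type*) [PseudoMetricSpace X] [PseudoMetricSpace Y] : Prop :=
  ∃ f : X → Y, IsCoarseEmbedding f

/-- The family `(X i)` equi-coarsely embeds into `Y`: there are non-decreasing
`ρ, ω : [0, ∞) → [0, ∞)` with `ρ(t) → ∞`, and maps `f i : X i → Y` with `ρ ≤ ρ_{f i}` and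
`ω_{f i} ≤ ω` for all `i`. (Finiteness of `ω` is part of its type.) -/
def EquiCoarselyEmbeds {I : Type*} (X : I → Type*) [∀ i, PseudoMetricSpace (X i)]
    (Y : Type*) [PseudoMetricSpace Y] : Prop :=
  ∃ ρ ω : ℝ≥0 → ℝ≥0, Monotone ρ ∧ Monotone ω ∧ Tendsto ρ atTop atTop ∧
    ∃ f : ∀ i, X i → Y, ∀ i, ∀ t : ℝ≥0,
      (ρ t : ℝ≥0∞) ≤ compressionModulus (f i) t ∧ expansionModulus (f i) t ≤ (ω t : ℝ≥0∞)

/-- The longest common initial segment of two finite sets of natural numbers, both listed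
increasingly: `x` belongs to it iff `x` is in both sets and the sets agree below `x`. -/
def commonInit (m n : Finset ℕ) : Finset ℕ :=
  (m ∩ n).filter fun x => ∀ y < x, (y ∈ m ↔ y ∈ n)

theorem mem_commonInit {m n : Finset ℕ} {x : ℕ} :
    x ∈ commonInit m n ↔ (x ∈ m ∧ x ∈ n) ∧ ∀ y < x, (y ∈ m ↔ y ∈ n) := by
  simp [commonInit]

theorem commonInit_self (m : Finset ℕ) : commonInit m m = m := by
  ext x; simp [mem_commonInit]

theorem commonInit_comm (m n : Finset ℕ) : commonInit m n = commonInit n m := by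
  ext x
  simp only [mem_commonInit]
  constructor <;> rintro ⟨⟨h1, h2⟩, h3⟩ <;> exact ⟨⟨h2, h1⟩, fun y hy => (h3 y hy).symm⟩

theorem commonInit_subset_left (m n : Finset ℕ) : commonInit m n ⊆ m :=
  fun _ hx => (mem_commonInit.1 hx).1.1

theorem commonInit_subset_right (m n : Finset ℕ) : commonInit m n ⊆ n :=
  fun _ hx => (mem_commonInit.1 hx).1.2

theorem commonInit_trans {m n p : Finset ℕ} {x : ℕ} (h : x ∈ commonInit m n)
    (h' : x ∈ commonInit n p) : x ∈ commonInit m p := by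
  rw [mem_commonInit] at *
  exact ⟨⟨h.1.1, h'.1.2⟩, fun y hy => (h.2 y hy).trans (h'.2 y hy)⟩

theorem commonInit_total (m n p : Finset ℕ) :
    commonInit m n ⊆ commonInit n p ∨ commonInit n p ⊆ commonInit m n := by
  by_contra hcon
  push Not at hcon
  obtain ⟨h1, h2⟩ := hcon
  obtain ⟨x, hx, hx'⟩ := Finset.not_subset.1 h1
  obtain ⟨y, hy, hy'⟩ := Finset.not_subset.1 h2
  rw [mem_commonInit] at *
  rcases lt_trichotomy x y with h | h | h
  · exact hx' ⟨⟨hx.1.2, (hy.2 x h).1 hx.1.2⟩, fun z hz => hy.2 z (hz.trans h)⟩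
  · subst h
    exact hx' hy
  · exact hy' ⟨⟨(hx.2 y h).2 hy.1.1, hy.1.1⟩, fun z hz => hx.2 z (hz.trans h)⟩

theorem card_commonInit_triangle (m n p : Finset ℕ) :
    (commonInit m n).card + (commonInit n p).card ≤ n.card + (commonInit m p).card := by
  rcases commonInit_total m n p with h | h
  · have h1 : (commonInit m n).card ≤ (commonInit m p).card :=
      Finset.card_le_card fun x hx => commonInit_trans hx (h hx)
    have h2 := Finset.card_le_card (commonInit_subset_left n p)
    omega
  · have h1 : (commonInit n p).card ≤ (commonInit m p).card :=
      Finset.card_le_card fun x hx => commonInit_trans (h hx) hx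
    have h2 := Finset.card_le_card (commonInit_subset_right m n)
    omega

/-- The vertices of the countably branching tree `T_∞^ω` of infinite height: the finite subsets
of `ℕ`. The children of a vertex `s` are the sets `s ∪ {j}` with `j` larger than all elements
of `s`. -/
@[ext]
structure TreeInf : Type where
  toFinset : Finset ℕ

/-- The tree metric `d_T(m, n) = |m| + |n| - 2 |m ∧ n|`. -/
noncomputable instance : MetricSpace TreeInf where
  dist m n := (m.toFinset.card : ℝ) + (n.toFinset.card : ℝ)
    - 2 * ((commonInit m.toFinset n.toFinset).card : ℝ)
  dist_self m := by
    rw [commonInit_self]; ring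
  dist_comm m n := by
    rw [commonInit_comm]; ring
  dist_triangle m n p := by
    have h : ((commonInit m.toFinset n.toFinset).card : ℝ)
        + ((commonInit n.toFinset p.toFinset).card : ℝ)
        ≤ (n.toFinset.card : ℝ) + ((commonInit m.toFinset p.toFinset).card : ℝ) := by
      exact_mod_cast card_commonInit_triangle m.toFinset n.toFinset p.toFinset
    linarith
  eq_of_dist_eq_zero := by
    intro m n h
    have h1 := Finset.card_le_card (commonInit_subset_left m.toFinset n.toFinset)
    have h2 := Finset.card_le_card (commonInit_subset_right m.toFinset n.toFinset)
    have h3 : m.toFinset.card + n.toFinset.card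
        = 2 * (commonInit m.toFinset n.toFinset).card := by
      have h' := sub_eq_zero.1 h
      exact_mod_cast h'
    have e1 := Finset.eq_of_subset_of_card_le
      (commonInit_subset_left m.toFinset n.toFinset) (by omega)
    have e2 := Finset.eq_of_subset_of_card_le
      (commonInit_subset_right m.toFinset n.toFinset) (by omega)
    exact TreeInf.ext (e1.symm.trans e2)

/-- The countably branching tree `T_k^ω` of height `k`: the subsets of `ℕ` with at most `k`
elements, with the restriction of the tree metric. -/
abbrev TreeOfHeight (k : ℕ) : Type := {m : TreeInf // m.toFinset.card ≤ k}

end CoarseTree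

/-!
Finite-dimensional spaces are excluded by compactness: a tree of large finite height contains
infinitely many points at the same large mutual distance, and their images would form a bounded
separated sequence (`not_equiCoarselyEmbeds_of_properSpace`). A coarse embedding of the whole tree
restricts to equi-coarse embeddings of the trees of finite height. It remains to embed the tree
coarsely into an infinite-dimensional space `Y`.

Consider the game in which one player chooses subspaces of finite codimension, the other answers
with unit vectors in them, and the first player tries to force the sum of these vectors out of the
ball of radius `C` (`Escapes`). Exactly one of two cases occurs.

* For every `C` the ball can be escaped within some number of moves. Following all these
  strategies at once, one chooses a basic sequence whose signed sums are large as soon as they have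
  many terms (`exists_isBasicSeq_norm_signed_sum`). The sequence is indexed by the vertices of the
  tree, and a vertex is sent to the sum of the basis vectors along its path from the root. The
  difference of two images is a signed sum of as many terms as the distance of the two vertices.

* For some `C` the ball cannot be escaped in any number of moves. Cut the levels of the tree into
  the dyadic blocks `[2 ^ j, 2 ^ (j + 1))` and play a new game on each block of each branch: this
  puts a basic sequence on the vertices whose sums over the initial part of a block of a branch
  stay in the ball (`exists_isBasicSeq_norm_sum_block_le`). Send a vertex to the sum of these block
  sums along its path from the root. This map is Lipschitz. A vertex on one of two branches, above
  the common part, contributes its basis vector with the number of levels from it on that the branch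
  has in its block as coefficient, and a long branch has a vertex with a large coefficient
  (`le_norm_sub_sum_block`). As in the space `c₀`, one large coefficient is enough.

Subspaces of finite codimension enter through the filter `farSphere` alone; that basic sequences
can be chosen along it is Mazur's lemma (`eventually_farSphere_norm_le`).
-/

namespace CoarseTree

/-! ### Initial segments -/

/-- The nonempty initial segments of `m`, listed increasingly. They are the vertices other than
the root on the path from the root to `m` in the tree. -/
def pre (m : Finset ℕ) : Finset (Finset ℕ) :=
  m.powerset.filter fun s => s.Nonempty ∧ ∀ x ∈ s, ∀ y ∈ m, y ≤ x → y ∈ s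

theorem mem_pre {m s : Finset ℕ} :
    s ∈ pre m ↔ s ⊆ m ∧ s.Nonempty ∧ ∀ x ∈ s, ∀ y ∈ m, y ≤ x → y ∈ s := by
  simp [pre]

theorem self_mem_pre {m : Finset ℕ} (h : m.Nonempty) : m ∈ pre m :=
  mem_pre.2 ⟨subset_rfl, h, fun _ _ _ h _ => h⟩

theorem pre_eq_image (m : Finset ℕ) : pre m = m.image fun j => m.filter (· ≤ j) := by
  ext s
  simp only [mem_pre, Finset.mem_image]
  constructor
  · rintro ⟨h1, h2, h3⟩
    refine ⟨s.max' h2, h1 (s.max'_mem h2), ?_⟩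
    ext y
    simp only [Finset.mem_filter]
    exact ⟨fun h => h3 _ (s.max'_mem h2) y h.1 h.2, fun h => ⟨h1 h, s.le_max' y h⟩⟩
  · rintro ⟨j, hj, rfl⟩
    refine ⟨Finset.filter_subset _ _, ⟨j, by simp [hj]⟩, ?_⟩
    intro x hx y hy hyx
    simp only [Finset.mem_filter] at hx ⊢
    exact ⟨hy, hyx.trans hx.2⟩

theorem card_pre (m : Finset ℕ) : (pre m).card = m.card := by
  rw [pre_eq_image, Finset.card_image_of_injOn]
  intro i hi j hj hij
  have h1 : i ∈ m.filter (· ≤ j) := by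
    simp only at hij
    rw [← hij]; simpa using hi
  have h2 : j ∈ m.filter (· ≤ i) := by
    simp only at hij
    rw [hij]; simpa using hj
  exact le_antisymm (Finset.mem_filter.1 h1).2 (Finset.mem_filter.1 h2).2

theorem pre_inter_pre (m n : Finset ℕ) : pre m ∩ pre n = pre (commonInit m n) := by
  ext s
  simp only [Finset.mem_inter, mem_pre]
  constructor
  · rintro ⟨⟨h1, h2, h3⟩, h4, -, h5⟩
    refine ⟨fun x hx => mem_commonInit.2 ⟨⟨h1 hx, h4 hx⟩, fun y hy => ?_⟩, h2, ?_⟩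
    · exact ⟨fun h => h4 (h3 x hx y h hy.le), fun h => h1 (h5 x hx y h hy.le)⟩
    · exact fun x hx y hy hyx => h3 x hx y (commonInit_subset_left _ _ hy) hyx
  · rintro ⟨h1, h2, h3⟩
    refine ⟨⟨h1.trans (commonInit_subset_left _ _), h2, ?_⟩,
      h1.trans (commonInit_subset_right _ _), h2, ?_⟩
    · intro x hx y hy hyx
      rcases hyx.eq_or_lt with rfl | hlt
      · exact hx
      have h := mem_commonInit.1 (h1 hx)
      exact h3 x hx y (mem_commonInit.2
        ⟨⟨hy, (h.2 y hlt).1 hy⟩, fun z hz => h.2 z (hz.trans hlt)⟩) hyx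
    · intro x hx y hy hyx
      rcases hyx.eq_or_lt with rfl | hlt
      · exact hx
      have h := mem_commonInit.1 (h1 hx)
      exact h3 x hx y (mem_commonInit.2
        ⟨⟨(h.2 y hlt).2 hy, hy⟩, fun z hz => h.2 z (hz.trans hlt)⟩) hyx

theorem dist_eq_card_sdiff (m n : TreeInf) :
    dist m n = ((pre m.toFinset \ pre n.toFinset).card : ℝ)
      + ((pre n.toFinset \ pre m.toFinset).card : ℝ) := by
  have h1 := Finset.card_sdiff_add_card_inter (pre m.toFinset) (pre n.toFinset)
  have h2 := Finset.card_sdiff_add_card_inter (pre n.toFinset) (pre m.toFinset)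
  rw [pre_inter_pre, card_pre, card_pre] at h1 h2
  rw [commonInit_comm] at h2
  change (m.toFinset.card : ℝ) + (n.toFinset.card : ℝ)
    - 2 * ((commonInit m.toFinset n.toFinset).card : ℝ) = _
  rw [← h1, ← h2]
  push_cast
  ring

theorem pre_trans {s t m : Finset ℕ} (hs : s ∈ pre t) (ht : t ∈ pre m) : s ∈ pre m := by
  rw [mem_pre] at *
  exact ⟨hs.1.trans ht.1, hs.2.1, fun x hx y hy hyx =>
    hs.2.2 x hx y (ht.2.2 x (hs.1 hx) y hy hyx) hyx⟩

theorem pre_chain {s t m : Finset ℕ} (hs : s ∈ pre m) (ht : t ∈ pre m) (h : s.card ≤ t.card) :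
    s ∈ pre t := by
  rw [mem_pre] at *
  have hst : s ⊆ t := by
    by_contra hcon
    obtain ⟨x, hx, hxt⟩ := Finset.not_subset.1 hcon
    have hts : t ⊆ s := fun y hy => hs.2.2 x hx y (ht.1 hy)
      (not_lt.1 fun hlt => hxt (ht.2.2 y hy x (hs.1 hx) hlt.le))
    exact hcon (Finset.eq_of_subset_of_card_le hts h).ge
  exact ⟨hst, hs.2.1, fun x hx y hy hyx => hs.2.2 x hx y (ht.1 hy) hyx⟩

theorem card_le_of_mem_pre {s m : Finset ℕ} (h : s ∈ pre m) : s.card ≤ m.card :=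
  Finset.card_le_card (mem_pre.1 h).1

theorem card_injOn_pre (m : Finset ℕ) : Set.InjOn Finset.card (pre m : Set (Finset ℕ)) := by
  intro s hs t ht h
  have h1 := (mem_pre.1 (pre_chain hs ht h.le)).1
  exact Finset.eq_of_subset_of_card_le h1 h.ge

theorem image_card_pre (m : Finset ℕ) : (pre m).image Finset.card = Finset.Icc 1 m.card := by
  apply Finset.eq_of_subset_of_card_le
  · intro k hk
    obtain ⟨s, hs, rfl⟩ := Finset.mem_image.1 hk
    exact Finset.mem_Icc.2 ⟨(mem_pre.1 hs).2.1.card_pos, card_le_of_mem_pre hs⟩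
  · rw [Finset.card_image_of_injOn (card_injOn_pre m), card_pre]
    simp

theorem exists_mem_pre {m : Finset ℕ} {k : ℕ} (h1 : 1 ≤ k) (h2 : k ≤ m.card) :
    ∃ s ∈ pre m, s.card = k := by
  have : k ∈ (pre m).image Finset.card := by
    rw [image_card_pre]; exact Finset.mem_Icc.2 ⟨h1, h2⟩
  simpa using this

/-- The initial segments of `m` that are not initial segments of `n` are those longer than the
common part. -/
theorem notMem_pre_of_card_lt {s m n : Finset ℕ} (hs : s ∈ pre m)
    (h : (commonInit m n).card < s.card) : s ∉ pre n := fun hn => by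
  have : s ∈ pre (commonInit m n) := by
    rw [← pre_inter_pre]; exact Finset.mem_inter.2 ⟨hs, hn⟩
  exact absurd (card_le_of_mem_pre this) (by omega)

/-- A vertex with at least two elements has a parent. -/
theorem exists_pre_erase {s : Finset ℕ} (h : 2 ≤ s.card) :
    ∃ t ∈ pre s, t.card + 1 = s.card ∧ (pre s).erase s = pre t := by
  obtain ⟨t, ht, htc⟩ := exists_mem_pre (m := s) (k := s.card - 1) (by omega) (by omega)
  refine ⟨t, ht, by omega, ?_⟩
  ext r
  rw [Finset.mem_erase]
  constructor
  · rintro ⟨h1, h2⟩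
    refine pre_chain h2 ht ?_
    have h3 := Finset.card_lt_card ((mem_pre.1 h2).1.ssubset_of_ne h1)
    omega
  · intro hr
    refine ⟨?_, pre_trans hr ht⟩
    rintro rfl
    have := card_le_of_mem_pre hr
    omega

/-! ### An enumeration of the tree -/

/-- The enumeration `s ↦ ∑ i ∈ s, 2 ^ i` of the vertices; ancestors come before descendants. -/
abbrev code : Finset ℕ ≃ ℕ := Finset.equivBitIndices.symm

theorem code_lt_code {s m : Finset ℕ} (h : s ∈ pre m) (hne : s ≠ m) : code s < code m := by
  have := (mem_pre.1 h).1.ssubset_of_ne hne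
  obtain ⟨a, ha, has⟩ := Finset.exists_of_ssubset this
  change ∑ i ∈ s, 2 ^ i < ∑ i ∈ m, 2 ^ i
  exact Finset.sum_lt_sum_of_subset this.1 ha has (by positivity) (by simp)

/-! ### Coarse embeddings of the tree -/

theorem IsCoarseEmbedding.of_bounds {X Y : Type*} [PseudoMetricSpace X] [PseudoMetricSpace Y]
    (f : X → Y) (C : ℝ) (hC : ∀ x y, dist (f x) (f y) ≤ C * dist x y)
    (hR : ∀ R : ℝ, ∃ D : ℝ, ∀ x y, D ≤ dist x y → R ≤ dist (f x) (f y)) :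
    IsCoarseEmbedding f := by
  constructor
  · rw [ENNReal.tendsto_nhds_top_iff_nnreal]
    intro R
    obtain ⟨D, hD⟩ := hR (R + 1)
    filter_upwards [eventually_ge_atTop D.toNNReal] with t ht
    refine lt_of_lt_of_le (b := ((R + 1 : ℝ≥0) : ℝ≥0∞)) (by exact_mod_cast lt_add_one R) ?_
    refine le_iInf fun x => le_iInf fun y => le_iInf fun hxy => ?_
    rw [edist_nndist]
    norm_cast
    rw [← NNReal.coe_le_coe]
    push_cast
    exact hD x y ((Real.le_coe_toNNReal D).trans (by exact_mod_cast ht.trans hxy))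
  · intro t _
    refine lt_of_le_of_lt (b := ((C.toNNReal * t : ℝ≥0) : ℝ≥0∞)) ?_ ENNReal.coe_lt_top
    refine iSup_le fun x => iSup_le fun y => iSup_le fun hxy => ?_
    rw [edist_nndist]
    norm_cast
    rw [← NNReal.coe_le_coe]
    push_cast
    refine (hC x y).trans ?_
    have h1 : dist x y ≤ t := by exact_mod_cast hxy
    exact mul_le_mul (Real.le_coe_toNNReal C) h1 dist_nonneg (by positivity)

/-- Summing vectors of norm at most `C` along the path from the root gives a Lipschitz map. -/
theorem dist_sum_pre_le {Y : Type*} [SeminormedAddCommGroup Y] (u : Finset ℕ → Y) (C : ℝ)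
    (hu : ∀ t : Finset ℕ, t.Nonempty → ‖u t‖ ≤ C) (m n : TreeInf) :
    dist (∑ t ∈ pre m.toFinset, u t) (∑ t ∈ pre n.toFinset, u t) ≤ C * dist m n := by
  have key : ∀ a b : Finset ℕ, ‖∑ t ∈ pre a \ pre b, u t‖ ≤ (pre a \ pre b).card * C := by
    intro a b
    refine (norm_sum_le_of_le _ (f := u) (n := fun _ => C) fun t ht => hu t
      (mem_pre.1 (Finset.mem_sdiff.1 ht).1).2.1).trans ?_
    simp
  rw [dist_eq_norm, ← Finset.sum_sdiff_sub_sum_sdiff, dist_eq_card_sdiff]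
  refine (norm_sub_le _ _).trans ?_
  linarith [key m.toFinset n.toFinset, key n.toFinset m.toFinset]

/-- A coarse embedding of the whole tree restricts to an equi-coarse embedding of the trees of
finite height. -/
theorem CoarselyEmbeds.equiCoarselyEmbeds {Y : Type*} [PseudoMetricSpace Y]
    (h : CoarselyEmbeds TreeInf Y) :
    EquiCoarselyEmbeds (fun k : ℕ+ => TreeOfHeight (k : ℕ)) Y := by
  obtain ⟨f, hf1, hf2⟩ := h
  have hmono : Monotone (compressionModulus f) := fun s t hst =>
    le_iInf fun x => le_iInf fun y => le_iInf fun hxy =>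
      (iInf_le_of_le x <| iInf_le_of_le y <| iInf_le_of_le (hst.trans hxy) le_rfl)
  have hmono' : Monotone (expansionModulus f) := fun s t hst =>
    iSup_le fun x => iSup_le fun y => iSup_le fun hxy =>
      (le_iSup_of_le x <| le_iSup_of_le y <| le_iSup_of_le (hxy.trans hst) le_rfl)
  have hfin : ∀ t, expansionModulus f t ≠ ⊤ := fun t =>
    ((hmono' (le_add_of_nonneg_right zero_le_one)).trans_lt (hf2 (t + 1) (by positivity))).ne
  -- The compression modulus may be infinite; truncating it at `t` makes it finite.
  have hne : ∀ t : ℝ≥0, min (compressionModulus f t) t ≠ ⊤ := fun t =>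
    ((min_le_right _ _).trans_lt ENNReal.coe_lt_top).ne
  refine ⟨fun t => (min (compressionModulus f t) t).toNNReal,
    fun t => (expansionModulus f t).toNNReal, ?_, ?_, ?_, fun k x => f x, fun k t => ⟨?_, ?_⟩⟩
  · intro s t hst
    exact ENNReal.toNNReal_mono (hne t) (min_le_min (hmono hst) (by exact_mod_cast hst))
  · exact fun s t hst => ENNReal.toNNReal_mono (hfin t) (hmono' hst)
  · rw [tendsto_atTop]
    intro R
    filter_upwards [eventually_ge_atTop R, hf1.eventually (lt_mem_nhds ENNReal.coe_lt_top)]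
      with t h1 h2
    rw [← ENNReal.coe_le_coe, ENNReal.coe_toNNReal (hne t)]
    exact le_min h2.le (by exact_mod_cast h1)
  · rw [ENNReal.coe_toNNReal (hne t)]
    refine (min_le_left _ _).trans ?_
    exact le_iInf fun x => le_iInf fun y => le_iInf fun hxy =>
      (iInf_le_of_le x.1 <| iInf_le_of_le y.1 <| iInf_le_of_le hxy le_rfl)
  · rw [ENNReal.coe_toNNReal (hfin t)]
    exact iSup_le fun x => iSup_le fun y => iSup_le fun hxy =>
      (le_iSup_of_le x.1 <| le_iSup_of_le y.1 <| le_iSup_of_le hxy le_rfl)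

/-! ### Finite-dimensional targets -/

/-- In a tree of finite height `k`, the disjoint blocks of `k` integers form an infinite set of
points at mutual distance `2 k`; a large `k` forces their images to be separated and bounded. -/
theorem not_equiCoarselyEmbeds_of_properSpace (Y : Type*) [PseudoMetricSpace Y] [ProperSpace Y] :
    ¬ EquiCoarselyEmbeds (fun k : ℕ+ => TreeOfHeight (k : ℕ)) Y := by
  rintro ⟨ρ, ω, hρ, -, hlim, f, hf⟩
  obtain ⟨k, hk1, hk⟩ : ∃ k : ℕ, 1 ≤ k ∧ 1 ≤ ρ (2 * k : ℕ) := by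
    have h1 := (tendsto_natCast_atTop_atTop (R := ℝ≥0)).eventually
      (hlim.eventually (eventually_ge_atTop 1))
    obtain ⟨k, hk1, hk2⟩ := ((eventually_ge_atTop 1).and h1).exists
    exact ⟨k, hk1, hk2.trans (hρ (by gcongr; omega))⟩
  let K : ℕ+ := ⟨k, hk1⟩
  let B : ℕ → TreeOfHeight (K : ℕ) := fun i =>
    ⟨⟨Finset.Ico (i * k) ((i + 1) * k)⟩, by simp [K, add_mul]⟩
  have hB : ∀ i j, i ≠ j → nndist (B i) (B j) = (2 * k : ℕ) := by
    intro i j hij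
    have hci : commonInit (B i).1.toFinset (B j).1.toFinset = ∅ := by
      rw [Finset.eq_empty_iff_forall_notMem]
      intro x hx
      have h1 := Finset.mem_Ico.1 (commonInit_subset_left _ _ hx)
      have h2 := Finset.mem_Ico.1 (commonInit_subset_right _ _ hx)
      rcases hij.lt_or_gt with h | h
      · have : (i + 1) * k ≤ j * k := Nat.mul_le_mul_right k h
        omega
      · have : (j + 1) * k ≤ i * k := Nat.mul_le_mul_right k h
        omega
    rw [← NNReal.coe_inj, coe_nndist]
    change ((B i).1.toFinset.card : ℝ) + ((B j).1.toFinset.card : ℝ)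
      - 2 * ((commonInit (B i).1.toFinset (B j).1.toFinset).card : ℝ) = _
    rw [hci]
    have hc : ∀ i, (B i).1.toFinset.card = k := fun i => by simp [B, add_mul]
    rw [hc, hc]
    push_cast
    simp
    ring
  have hlow : ∀ i j, i ≠ j → 1 ≤ dist (f K (B i)) (f K (B j)) := by
    intro i j hij
    have h1 : ((ρ (2 * k : ℕ) : ℝ≥0) : ℝ≥0∞) ≤ edist (f K (B i)) (f K (B j)) :=
      (hf K (2 * k : ℕ)).1.trans
        (iInf_le_of_le (B i) <| iInf_le_of_le (B j) <| iInf_le_of_le (hB i j hij).ge le_rfl)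
    rw [edist_nndist] at h1
    exact_mod_cast hk.trans (ENNReal.coe_le_coe.1 h1)
  have hup : ∀ i, dist (f K (B i)) (f K (B 0)) ≤ ω (2 * k : ℕ) := by
    intro i
    have h0 : nndist (B i) (B 0) ≤ (2 * k : ℕ) := by
      rcases eq_or_ne i 0 with rfl | h
      · simp
      · exact (hB i 0 h).le
    have h1 : edist (f K (B i)) (f K (B 0)) ≤ ((ω (2 * k : ℕ) : ℝ≥0) : ℝ≥0∞) :=
      le_trans (le_iSup_of_le (B i) <| le_iSup_of_le (B 0) <|
        le_iSup (fun _ => edist (f K (B i)) (f K (B 0))) h0)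
        (hf K (2 * k : ℕ)).2
    rw [edist_nndist] at h1
    exact_mod_cast ENNReal.coe_le_coe.1 h1
  obtain ⟨a, -, φ, hφ, ha⟩ := tendsto_subseq_of_bounded
    (Metric.isBounded_closedBall (x := f K (B 0)) (r := ω (2 * k : ℕ)))
    (x := fun i => f K (B i)) (fun i => Metric.mem_closedBall.2 (hup i))
  obtain ⟨N, hN⟩ := Metric.cauchySeq_iff'.1 ha.cauchySeq 1 one_pos
  exact absurd (hN (N + 1) (by omega)) (not_lt.2 (hlow _ _ (hφ.injective.ne (by omega))))

/-! ### Unit vectors far from finite-dimensional subspaces -/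

section FarSphere

variable (𝕜 : Type*) [RCLike 𝕜] (Y : Type*) [NormedAddCommGroup Y] [NormedSpace 𝕜 Y]

/-- The filter on `Y` generated by the unit spheres of the closed subspaces of finite codimension.
A property holds eventually along it iff it holds for all unit vectors annihilated by suitable
finitely many functionals. -/
def farSphere : Filter Y :=
  𝓟 {x | ‖x‖ = 1} ⊓ ⨅ g : StrongDual 𝕜 Y, 𝓟 {x | g x = 0}

variable {Y}

theorem eventually_farSphere_norm : ∀ᶠ x in farSphere 𝕜 Y, ‖x‖ = 1 :=
  mem_inf_of_left (mem_principal_self _)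

variable {𝕜}

theorem eventually_farSphere_apply (g : StrongDual 𝕜 Y) : ∀ᶠ x in farSphere 𝕜 Y, g x = 0 :=
  mem_inf_of_right (mem_iInf_of_mem g (mem_principal_self _))

theorem tendsto_neg_farSphere : Tendsto (fun x => -x) (farSphere 𝕜 Y) (farSphere 𝕜 Y) := by
  conv => arg 3; unfold farSphere
  rw [tendsto_inf, tendsto_iInf]
  simp only [tendsto_principal, Set.mem_ofPred_eq, norm_neg, map_neg, neg_eq_zero]
  exact ⟨eventually_farSphere_norm 𝕜, eventually_farSphere_apply⟩

theorem farSphere_neBot (h : ¬ FiniteDimensional 𝕜 Y) : (farSphere 𝕜 Y).NeBot := by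
  unfold farSphere
  rw [((hasBasis_iInf_principal_finite _).principal_inf _).neBot_iff]
  intro t ht
  have : Finite t := ht
  -- On an infinite-dimensional space, finitely many functionals have a common zero.
  let T : Y →ₗ[𝕜] (t → 𝕜) := LinearMap.pi fun g => (g.1 : Y →ₗ[𝕜] 𝕜)
  have hT : ¬ Function.Injective T := fun hinj => h (Module.Finite.of_injective T hinj)
  rw [← LinearMap.ker_eq_bot, Submodule.eq_bot_iff] at hT
  push Not at hT
  obtain ⟨x, hx, hx0⟩ := hT
  refine ⟨((‖x‖⁻¹ : ℝ) : 𝕜) • x, ?_, ?_⟩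
  · simp [norm_smul, hx0]
  · simp only [Set.mem_iInter, Set.mem_ofPred_eq, map_smul]
    intro g hg
    have : T x ⟨g, hg⟩ = 0 := by rw [LinearMap.mem_ker.1 hx]; rfl
    have h1 : g x = 0 := this
    rw [h1, smul_zero]

/-- Mazur's lemma: unit vectors far out are almost orthogonal to a given finite-dimensional
subspace. -/
theorem eventually_farSphere_norm_le (E : Submodule 𝕜 Y) [FiniteDimensional 𝕜 E] {r : ℝ}
    (hr : r < 1) :
    ∀ᶠ x in farSphere 𝕜 Y, ∀ u ∈ E, ∀ b : 𝕜, r * ‖u‖ ≤ ‖u + b • x‖ := by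
  have : ProperSpace E := FiniteDimensional.proper 𝕜 E
  have hK : IsCompact (Metric.sphere (0 : E) 1) := isCompact_sphere _ _
  obtain ⟨t, htK, ht, htc⟩ := hK.finite_cover_balls (sub_pos.2 hr)
  choose g hg1 hg2 using fun v : E => exists_dual_vector'' 𝕜 (v : Y)
  have hev : ∀ᶠ x in farSphere 𝕜 Y, ∀ v ∈ t, g v x = 0 :=
    (eventually_all_finite ht).2 fun v _ => eventually_farSphere_apply _
  filter_upwards [hev] with x hx u hu b
  rcases eq_or_ne u 0 with rfl | hu0
  · simp
  have hn : 0 < ‖u‖ := norm_pos_iff.2 hu0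
  -- `c • u` is the normalization of `u`, close to a point `v` of the net.
  set c : 𝕜 := ((‖u‖⁻¹ : ℝ) : 𝕜) with hc
  have hcn : ‖c‖ = ‖u‖⁻¹ := by simp [hc]
  have hmem : (⟨c • u, E.smul_mem c hu⟩ : E) ∈ Metric.sphere (0 : E) 1 := by
    simp [norm_smul, hcn, hn.ne']
  obtain ⟨v, hv, hvd⟩ := Set.mem_iUnion₂.1 (htc hmem)
  rw [Metric.mem_ball, Subtype.dist_eq, dist_eq_norm] at hvd
  simp only at hvd
  have h1 : ‖g v (c • u + (c * b) • x)‖ ≤ ‖c • u + (c * b) • x‖ :=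
    ((g v).le_of_opNorm_le (hg1 v) _).trans_eq (one_mul _)
  have h2 : g v (c • u + (c * b) • x) = g v (c • u) := by
    rw [map_add, map_smul (g v) (c * b), hx v hv, smul_zero, add_zero]
  have h3 : ‖g v (c • u - v)‖ ≤ ‖c • u - v‖ :=
    ((g v).le_of_opNorm_le (hg1 v) _).trans_eq (one_mul _)
  have h4 : ‖g v v‖ = 1 := by
    have hv1 : ‖(v : Y)‖ = 1 := by simpa using htK hv
    rw [hg2, hv1]
    simp
  have h6 : ‖g v v‖ ≤ ‖g v (c • u)‖ + ‖g v (c • u - v)‖ := by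
    rw [map_sub]
    have := norm_sub_le (g v (c • u)) (g v (c • u) - g v v)
    rwa [sub_sub_cancel] at this
  have key : r ≤ ‖c • u + (c * b) • x‖ := by
    rw [h2] at h1
    linarith
  have h7 : c • u + (c * b) • x = c • (u + b • x) := by rw [smul_add, smul_smul]
  rw [h7, norm_smul, hcn, inv_mul_eq_div, le_div_iff₀ hn] at key
  exact key

end FarSphere

/-! ### Basic sequences -/

section Basic

variable {𝕜 : Type*} [RCLike 𝕜] {Y : Type*} [NormedAddCommGroup Y] [NormedSpace 𝕜 Y]

/-- Dependent choice for sequences whose `n`-th term is subject to a condition on its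
predecessors. -/
theorem exists_seq_of_forall_exists {α : Type*} [Nonempty α] (Q : ℕ → (ℕ → α) → α → Prop)
    (hcongr : ∀ n x x' y, (∀ i < n, x i = x' i) → Q n x y → Q n x' y)
    (step : ∀ n x, (∀ i < n, Q i x (x i)) → ∃ y, Q n x y) : ∃ x : ℕ → α, ∀ n, Q n x (x n) := by
  have hstep : ∀ n (x : {x : ℕ → α // ∀ i < n, Q i x (x i)}),
      ∃ x' : {x : ℕ → α // ∀ i < n + 1, Q i x (x i)}, ∀ i < n, x.1 i = x'.1 i := by
    rintro n ⟨x, hx⟩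
    obtain ⟨y, hy⟩ := step n x hx
    have hag : ∀ i < n, x i = Function.update x n y i := fun i hi => by
      rw [Function.update_of_ne hi.ne]
    refine ⟨⟨Function.update x n y, fun i hi => ?_⟩, hag⟩
    rcases (Nat.lt_succ_iff.1 hi).eq_or_lt with rfl | h
    · rw [Function.update_self]
      exact hcongr _ _ _ _ hag hy
    · rw [← hag i h]
      exact hcongr _ _ _ _ (fun j hj => hag j (hj.trans h)) (hx i h)
  choose g hg using hstep
  let X : ∀ n, {x : ℕ → α // ∀ i < n, Q i x (x i)} := fun n =>
    Nat.rec ⟨Classical.arbitrary _, fun i hi => absurd hi (Nat.not_lt_zero i)⟩ (fun n x => g n x) n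
  have hX : ∀ n, ∀ i < n, (X n).1 i = (X (n + 1)).1 i := fun n => hg n (X n)
  have hX' : ∀ i d, (X (i + 1)).1 i = (X (i + 1 + d)).1 i := by
    intro i d
    induction d with
    | zero => rfl
    | succ d ih => rw [ih]; exact hX _ i (by omega)
  refine ⟨fun i => (X (i + 1)).1 i, fun n => ?_⟩
  refine hcongr n (X (n + 1)).1 _ _ (fun i hi => ?_) ((X (n + 1)).2 n (Nat.lt_succ_self n))
  obtain ⟨d, hd⟩ := Nat.exists_eq_add_of_le (show i + 1 ≤ n + 1 by omega)
  rw [hX' i d, ← hd]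

variable (𝕜) in
/-- `x` consists of unit vectors and is a basic sequence with basis constant at most `2`. -/
structure IsBasicSeq (x : ℕ → Y) : Prop where
  norm_eq_one : ∀ n, ‖x n‖ = 1
  norm_sum_le : ∀ (a : ℕ → 𝕜) (M N : ℕ), M ≤ N →
    ‖∑ i ∈ Finset.range M, a i • x i‖ ≤ 2 * ‖∑ i ∈ Finset.range N, a i • x i‖

/-- Sequences can be chosen basic whenever the choice of each term is made among vectors that
occur frequently along `farSphere`. -/
theorem exists_isBasicSeq (Q : ℕ → (ℕ → Y) → Y → Prop)
    (hcongr : ∀ n x x' y, (∀ i < n, x i = x' i) → Q n x y → Q n x' y)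
    (step : ∀ n x, (∀ i < n, Q i x (x i)) → ∃ᶠ y in farSphere 𝕜 Y, Q n x y) :
    ∃ x : ℕ → Y, IsBasicSeq 𝕜 x ∧ ∀ n, Q n x (x n) := by
  -- The basis constant is the product of the factors `c n / c (n + 1)`.
  set c : ℕ → ℝ := fun n => 1 + (2⁻¹ : ℝ) ^ n with hc
  have hc1 : ∀ n, 1 ≤ c n := fun n => by simp [hc]
  have hc2 : ∀ n, c n ≤ 2 := fun n => by
    have : (2⁻¹ : ℝ) ^ n ≤ 1 := pow_le_one₀ (by norm_num) (by norm_num)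
    simp only [hc]; linarith
  have hclt : ∀ n, c (n + 1) / c n < 1 := fun n => by
    rw [div_lt_one (by linarith [hc1 n])]
    have : (0 : ℝ) < 2⁻¹ ^ n := by positivity
    simp only [hc, pow_succ]; linarith
  obtain ⟨x, hx⟩ : ∃ x : ℕ → Y, ∀ n, Q n x (x n) ∧ ‖x n‖ = 1 ∧ ∀ (a : ℕ → 𝕜) (b : 𝕜),
      c (n + 1) / c n * ‖∑ i ∈ Finset.range n, a i • x i‖
        ≤ ‖∑ i ∈ Finset.range n, a i • x i + b • x n‖ := by
    refine exists_seq_of_forall_exists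
      (fun n x y => Q n x y ∧ ‖y‖ = 1 ∧ ∀ (a : ℕ → 𝕜) (b : 𝕜),
        c (n + 1) / c n * ‖∑ i ∈ Finset.range n, a i • x i‖
          ≤ ‖∑ i ∈ Finset.range n, a i • x i + b • y‖) ?_ ?_
    · rintro n x x' y hxx ⟨h1, h2, h3⟩
      refine ⟨hcongr _ _ _ _ hxx h1, h2, fun a b => ?_⟩
      have : ∑ i ∈ Finset.range n, a i • x' i = ∑ i ∈ Finset.range n, a i • x i :=
        Finset.sum_congr rfl fun i hi => by rw [hxx i (Finset.mem_range.1 hi)]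
      rw [this]
      exact h3 a b
    · intro n x hx
      let E : Submodule 𝕜 Y := Submodule.span 𝕜 (x '' (Finset.range n : Set ℕ))
      have : FiniteDimensional 𝕜 E :=
        FiniteDimensional.span_of_finite 𝕜 ((Finset.finite_toSet _).image _)
      have h1 := step n x fun i hi => (hx i hi).1
      obtain ⟨y, hy1, hy2, hy3⟩ := (h1.and_eventually ((eventually_farSphere_norm 𝕜).and
        (eventually_farSphere_norm_le E (hclt n)))).exists
      refine ⟨y, hy1, hy2, fun a b => hy3 _ ?_ b⟩
      exact Submodule.sum_mem _ fun i hi => E.smul_mem _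
        (Submodule.subset_span ⟨i, by simpa using hi, rfl⟩)
  refine ⟨x, ⟨fun n => (hx n).2.1, fun a M N hMN => ?_⟩, fun n => (hx n).1⟩
  have hmono : Monotone fun n => ‖∑ i ∈ Finset.range n, a i • x i‖ / c n := by
    refine monotone_nat_of_le_succ fun n => ?_
    have h := (hx n).2.2 a (a n)
    rw [← Finset.sum_range_succ] at h
    have h1 := hc1 n
    have h2 := hc1 (n + 1)
    rw [div_mul_eq_mul_div, div_le_iff₀ (by linarith)] at h
    rw [div_le_div_iff₀ (by linarith) (by linarith)]
    linarith
  have h := hmono hMN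
  have h1 := hc1 M
  have h2 := hc1 N
  have h3 := hc2 M
  simp only at h
  rw [div_le_iff₀ (by linarith), div_mul_eq_mul_div] at h
  refine h.trans ((div_le_self (by positivity) h2).trans ?_)
  nlinarith [norm_nonneg (∑ i ∈ Finset.range N, a i • x i)]

theorem IsBasicSeq.norm_coeff_le {x : ℕ → Y} (hx : IsBasicSeq 𝕜 x) (a : ℕ → 𝕜) {j N : ℕ}
    (hj : j < N) : ‖a j‖ ≤ 4 * ‖∑ i ∈ Finset.range N, a i • x i‖ := by
  have h1 := hx.norm_sum_le a (j + 1) N hj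
  have h2 := hx.norm_sum_le a j N hj.le
  have h3 : a j • x j = ∑ i ∈ Finset.range (j + 1), a i • x i
      - ∑ i ∈ Finset.range j, a i • x i := by rw [Finset.sum_range_succ, add_sub_cancel_left]
  calc ‖a j‖ = ‖a j • x j‖ := by rw [norm_smul, hx.norm_eq_one, mul_one]
    _ ≤ ‖∑ i ∈ Finset.range (j + 1), a i • x i‖ + ‖∑ i ∈ Finset.range j, a i • x i‖ := by
        rw [h3]; exact norm_sub_le _ _
    _ ≤ _ := by linarith

/-- A sum over vertices of the tree is a partial sum of the enumerated sequence. -/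
theorem exists_sum_eq_sum_range (x : ℕ → Y) (F : Finset (Finset ℕ)) (a : Finset ℕ → 𝕜)
    (ha : ∀ s ∉ F, a s = 0) :
    ∃ N, (∀ s ∈ F, code s < N) ∧
      ∑ s ∈ F, a s • x (code s) = ∑ i ∈ Finset.range N, a (code.symm i) • x i := by
  obtain ⟨N, hN⟩ := (F.image code).exists_nat_subset_range
  have hN' : ∀ s ∈ F, code s < N := fun s hs =>
    Finset.mem_range.1 (hN (Finset.mem_image_of_mem _ hs))
  refine ⟨N, hN', ?_⟩
  rw [← Finset.sum_subset hN, Finset.sum_image code.injective.injOn]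
  · simp only [Equiv.symm_apply_apply]
  · intro i _ hi
    rw [ha, zero_smul]
    exact fun h => hi (Finset.mem_image.2 ⟨_, h, Equiv.apply_symm_apply _ _⟩)

/-! ### The game of escaping a ball -/

variable (𝕜) in
/-- Starting from `u`, unit vectors are added one after the other. `Escapes 𝕜 C n u` says that a
player who restricts each of these vectors to a subspace of finite codimension of their choice
can force the sum out of the ball of radius `C` within `n` moves. -/
def Escapes (C : ℝ) : ℕ → Y → Prop
  | 0, u => C < ‖u‖
  | n + 1, u => C < ‖u‖ ∨ ∀ᶠ x in farSphere 𝕜 Y, Escapes C n (u + x)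

theorem norm_le_of_not_escapes {C : ℝ} {n : ℕ} {u : Y} (h : ¬ Escapes 𝕜 C n u) : ‖u‖ ≤ C := by
  cases n with
  | zero => exact not_lt.1 h
  | succ n => exact not_lt.1 fun h' => h (Or.inl h')

theorem frequently_not_escapes {C : ℝ} {n : ℕ} {u : Y} (h : ¬ Escapes 𝕜 C (n + 1) u) :
    ∃ᶠ x in farSphere 𝕜 Y, ¬ Escapes 𝕜 C n (u + x) :=
  fun h' => h (Or.inr (by simpa using h'))

/-- All sums `∑ i < n, a i • x i` with coefficients `0`, `1` and `-1`. -/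
def signedSums (𝕜 : Type*) [RCLike 𝕜] [NormedSpace 𝕜 Y] (x : ℕ → Y) (n : ℕ) : Set Y :=
  {u | ∃ a : ℕ → 𝕜, (∀ i, a i = 0 ∨ a i = 1 ∨ a i = -1) ∧ u = ∑ i ∈ Finset.range n, a i • x i}

theorem finite_signedSums (x : ℕ → Y) (n : ℕ) : (signedSums 𝕜 x n).Finite := by
  induction n with
  | zero =>
    refine (Set.finite_singleton (0 : Y)).subset ?_
    rintro u ⟨a, -, rfl⟩
    simp
  | succ n ih =>
    refine (Set.Finite.image2 (fun u (b : 𝕜) => u + b • x n) ih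
      (Set.toFinite {0, 1, -1})).subset ?_
    rintro u ⟨a, ha, rfl⟩
    exact ⟨_, ⟨a, ha, rfl⟩, a n, by simpa using ha n, by rw [Finset.sum_range_succ]⟩

theorem signedSums_congr {x x' : ℕ → Y} {n : ℕ} (h : ∀ i < n, x i = x' i) :
    signedSums 𝕜 x n = signedSums 𝕜 x' n := by
  have : ∀ a : ℕ → 𝕜, ∑ i ∈ Finset.range n, a i • x i = ∑ i ∈ Finset.range n, a i • x' i :=
    fun a => Finset.sum_congr rfl fun i hi => by rw [h i (Finset.mem_range.1 hi)]
  simp only [signedSums, this]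

/-- If every ball can be escaped, some basic sequence has large signed sums, whichever of its
terms are summed. -/
theorem exists_isBasicSeq_norm_signed_sum (hY : ¬ FiniteDimensional 𝕜 Y)
    (h : ∀ C : ℝ, ∃ n, Escapes 𝕜 C n (0 : Y)) :
    ∃ x : ℕ → Y, IsBasicSeq 𝕜 x ∧ ∀ R : ℝ, ∃ D : ℕ, ∀ (a : ℕ → 𝕜) (N : ℕ),
      (∀ i, a i = 0 ∨ a i = 1 ∨ a i = -1) → D ≤ ((Finset.range N).filter (a · ≠ 0)).card →
        R ≤ ‖∑ i ∈ Finset.range N, a i • x i‖ := by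
  have := farSphere_neBot hY
  choose D hD using fun C : ℕ => h C
  -- The `n`-th term continues the winning strategies for all signed sums of its predecessors
  -- and for all of the first `n + 1` radii.
  obtain ⟨x, hx, hxQ⟩ := exists_isBasicSeq (𝕜 := 𝕜)
    (fun n (x : ℕ → Y) y => ∀ C ∈ Finset.range (n + 1), ∀ j ∈ Finset.range (D C),
      ∀ u ∈ signedSums 𝕜 x n, Escapes 𝕜 (C : ℝ) (j + 1) u → (C : ℝ) < ‖u‖ ∨
        (Escapes 𝕜 (C : ℝ) j (u + y) ∧ Escapes 𝕜 (C : ℝ) j (u + -y)))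
    (fun n x x' y hxx hQ => by rw [← signedSums_congr hxx]; exact hQ)
    (fun n x _ => by
      refine Eventually.frequently ?_
      rw [eventually_all_finset]; intro C _
      rw [eventually_all_finset]; intro j _
      rw [eventually_all_finite (finite_signedSums x n)]; intro u _
      by_cases hu : Escapes 𝕜 (C : ℝ) (j + 1) u
      · rcases hu with hu | hu
        · exact Eventually.of_forall fun _ _ => Or.inl hu
        · filter_upwards [hu, tendsto_neg_farSphere.eventually hu] with y h1 h2 _
          exact Or.inr ⟨h1, h2⟩
      · exact Eventually.of_forall fun _ h => absurd h hu)
  have main : ∀ (C : ℕ) (a : ℕ → 𝕜), (∀ i, a i = 0 ∨ a i = 1 ∨ a i = -1) → (∀ i < C, a i = 0) →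
      ∀ N, (∃ M ≤ N, (C : ℝ) < ‖∑ i ∈ Finset.range M, a i • x i‖) ∨
        Escapes 𝕜 (C : ℝ) (D C - ((Finset.range N).filter (a · ≠ 0)).card)
          (∑ i ∈ Finset.range N, a i • x i) := by
    intro C a ha haC N
    induction N with
    | zero => right; simpa using hD C
    | succ N ih =>
      rcases ih with ⟨M, hM, hlt⟩ | ih
      · exact Or.inl ⟨M, by omega, hlt⟩
      by_cases haN : a N = 0
      · right
        rw [Finset.sum_range_succ, haN, zero_smul, add_zero, Finset.range_add_one,
          Finset.filter_insert, if_neg (by simpa using haN)]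
        exact ih
      rw [Finset.range_add_one, Finset.filter_insert, if_pos haN,
        Finset.card_insert_of_notMem (by simp), Finset.sum_insert (by simp), add_comm (a N • x N)]
      rcases Nat.eq_zero_or_pos (D C - ((Finset.range N).filter (a · ≠ 0)).card) with h0 | hpos
      · rw [h0] at ih
        exact Or.inl ⟨N, by omega, ih⟩
      obtain ⟨j, hj⟩ := Nat.exists_eq_add_of_lt hpos
      have hj' : D C - (((Finset.range N).filter (a · ≠ 0)).card + 1) = j := by omega
      rw [show D C - ((Finset.range N).filter (a · ≠ 0)).card = j + 1 by omega] at ih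
      rw [hj']
      have hCN : C ≤ N := not_lt.1 fun hlt => haN (haC N hlt)
      rcases hxQ N C (Finset.mem_range.2 (by omega)) j (Finset.mem_range.2 (by omega)) _
        ⟨a, ha, rfl⟩ ih with hlt | ⟨h1, h2⟩
      · exact Or.inl ⟨N, by omega, hlt⟩
      · right
        rcases ha N with h3 | h3 | h3
        · exact absurd h3 haN
        · rwa [h3, one_smul]
        · rwa [h3, neg_smul, one_smul]
  refine ⟨x, hx, fun R => ?_⟩
  obtain ⟨C, hC⟩ := exists_nat_ge (6 * R)
  -- The first `C` terms are not subject to the strategy for the radius `C`, so they are dropped.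
  refine ⟨D C + C, fun a N ha hcard => ?_⟩
  have hCN : C ≤ N := by
    have := (hcard.trans (Finset.card_filter_le _ _)).trans_eq (Finset.card_range N)
    omega
  set b : ℕ → 𝕜 := fun i => if i < C then 0 else a i with hb
  have hbcard : D C ≤ ((Finset.range N).filter (b · ≠ 0)).card := by
    have hsub : (Finset.range N).filter (a · ≠ 0) ⊆
        (Finset.range N).filter (b · ≠ 0) ∪ Finset.range C := by
      intro i hi
      simp only [Finset.mem_union, Finset.mem_filter, Finset.mem_range, hb] at hi ⊢
      by_cases hiC : i < C
      · exact Or.inr hiC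
      · exact Or.inl ⟨hi.1, by simpa [hiC] using hi.2⟩
    have h1 := (Finset.card_le_card hsub).trans (Finset.card_union_le _ _)
    rw [Finset.card_range] at h1
    omega
  have hbsum : ∑ i ∈ Finset.range N, b i • x i
      = ∑ i ∈ Finset.range N, a i • x i - ∑ i ∈ Finset.range C, a i • x i := by
    rw [eq_sub_iff_add_eq, ← Finset.sum_range_add_sum_Ico _ hCN,
      ← Finset.sum_range_add_sum_Ico (fun i => a i • x i) hCN]
    have h1 : ∑ i ∈ Finset.range C, b i • x i = 0 := Finset.sum_eq_zero fun i hi => by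
      simp [hb, Finset.mem_range.1 hi]
    have h2 : ∑ i ∈ Finset.Ico C N, b i • x i = ∑ i ∈ Finset.Ico C N, a i • x i :=
      Finset.sum_congr rfl fun i hi => by simp [hb, (Finset.mem_Ico.1 hi).1]
    rw [h1, h2]
    abel
  obtain ⟨M, hMN, hM⟩ : ∃ M ≤ N, (C : ℝ) < ‖∑ i ∈ Finset.range M, b i • x i‖ := by
    rcases main C b (fun i => by by_cases hi : i < C <;> simp [hb, hi, ha i])
      (fun i hi => by simp [hb, hi]) N with hM | hesc
    · exact hM
    · rw [Nat.sub_eq_zero_of_le hbcard] at hesc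
      exact ⟨N, le_rfl, hesc⟩
  have h1 := hx.norm_sum_le b M N hMN
  have h2 := hx.norm_sum_le a C N hCN
  have h3 := norm_sub_le (∑ i ∈ Finset.range N, a i • x i) (∑ i ∈ Finset.range C, a i • x i)
  rw [← hbsum] at h3
  linarith

end Basic

/-! ### Dyadic blocks of levels -/

/-- The initial segments of `t` whose level lies in the same dyadic block
`[2 ^ j, 2 ^ (j + 1))` as the level of `t`. -/
def block (t : Finset ℕ) : Finset (Finset ℕ) :=
  (pre t).filter fun s => Nat.log 2 s.card = Nat.log 2 t.card

theorem mem_block {s t : Finset ℕ} :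
    s ∈ block t ↔ s ∈ pre t ∧ Nat.log 2 s.card = Nat.log 2 t.card := by
  simp [block]

theorem self_mem_block {t : Finset ℕ} (h : t.Nonempty) : t ∈ block t :=
  mem_block.2 ⟨self_mem_pre h, rfl⟩

/-- The number of levels above `k` in the dyadic block of `k`. -/
def levelsLeft (k : ℕ) : ℕ := 2 ^ (Nat.log 2 k + 1) - 1 - k

theorem levelsLeft_eq_succ {k : ℕ} (h : Nat.log 2 k = Nat.log 2 (k + 1)) :
    levelsLeft k = levelsLeft (k + 1) + 1 := by
  have := Nat.lt_pow_succ_log_self (b := 2) (by norm_num) (k + 1)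
  unfold levelsLeft
  rw [h]
  omega

/-- Either a vertex is the first of its block on its branch, or its parent is in its block. -/
theorem block_erase_self (t : Finset ℕ) :
    (block t).erase t = ∅ ∨
      ∃ p ∈ pre t, p ≠ t ∧ levelsLeft p.card = levelsLeft t.card + 1 ∧
        (block t).erase t = block p := by
  rw [or_iff_not_imp_left, ← ne_eq, ← Finset.nonempty_iff_ne_empty]
  rintro ⟨s, hs⟩
  obtain ⟨hst, hs⟩ := Finset.mem_erase.1 hs
  obtain ⟨hs1, hs2⟩ := mem_block.1 hs
  have hlt := Finset.card_lt_card ((mem_pre.1 hs1).1.ssubset_of_ne hst)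
  have hpos := (mem_pre.1 hs1).2.1.card_pos
  obtain ⟨p, hp1, hp2, hp3⟩ := exists_pre_erase (s := t) (by omega)
  have hlog : Nat.log 2 p.card = Nat.log 2 t.card := by
    refine le_antisymm (Nat.log_mono_right (by omega)) ?_
    rw [← hs2]
    exact Nat.log_mono_right (by omega)
  refine ⟨p, hp1, ?_, ?_, ?_⟩
  · rintro rfl; omega
  · rw [levelsLeft_eq_succ (by rw [hp2, hlog]), hp2]
  · unfold block
    rw [← Finset.filter_erase, hp3, hlog]

theorem log_add_eq_log {r q i : ℕ} (hq : q ≠ 0) (hi : i < 2 ^ r) :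
    Nat.log 2 (q * 2 ^ r + i) = Nat.log 2 (q * 2 ^ r) := by
  have key : ∀ j < 2 ^ r, Nat.log 2 (q * 2 ^ r + j) = Nat.log 2 q + r := by
    intro j hj
    have h1 := Nat.mul_le_mul_right (2 ^ r) (Nat.pow_log_le_self 2 hq)
    have h2 : (q + 1) * 2 ^ r ≤ 2 ^ (Nat.log 2 q + 1) * 2 ^ r :=
      Nat.mul_le_mul_right (2 ^ r) (Nat.lt_pow_succ_log_self (by norm_num) q)
    rw [← pow_add] at h1 h2
    refine (Nat.log_eq_iff (Or.inr ⟨by norm_num, by positivity⟩)).2 ⟨by omega, ?_⟩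
    rw [add_mul, one_mul, add_right_comm] at h2
    omega
  rw [key i hi, ← key 0 (by positivity), add_zero]

/-- A branch of length at least `2 * 2 ^ r` above level `p` contains, in one dyadic block,
`2 ^ r` consecutive levels starting at some vertex above level `p`. -/
theorem exists_le_card_filter_block (r p : ℕ) (m : Finset ℕ) (h : p + 2 * 2 ^ r ≤ m.card) :
    ∃ s ∈ pre m, p < s.card ∧ 2 ^ r ≤ ((pre m).filter (s ∈ block ·)).card := by
  -- the first multiple of `2 ^ r` above `p`
  set R := 2 ^ r with hR
  have hRpos : 0 < R := by positivity
  set k := (p / R + 1) * R with hk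
  have h1 : p < k := by
    rw [hk, mul_comm]; exact Nat.lt_mul_div_succ p hRpos
  have h2 : k ≤ p + R := by
    rw [hk, add_mul, one_mul]; exact Nat.add_le_add_right (Nat.div_mul_le_self p R) R
  obtain ⟨s, hs, hsk⟩ := exists_mem_pre (m := m) (k := k) (by omega) (by omega)
  refine ⟨s, hs, by omega, ?_⟩
  calc R = (Finset.Ico k (k + R)).card := by simp
    _ ≤ (((pre m).filter (s ∈ block ·)).image Finset.card).card := by
      refine Finset.card_le_card fun l hl => ?_
      rw [Finset.mem_Ico] at hl
      obtain ⟨t, ht, htl⟩ := exists_mem_pre (m := m) (k := l) (by omega) (by omega)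
      refine Finset.mem_image.2 ⟨t, Finset.mem_filter.2 ⟨ht, mem_block.2
        ⟨pre_chain hs ht (by omega), ?_⟩⟩, htl⟩
      obtain ⟨i, rfl⟩ := Nat.exists_eq_add_of_le hl.1
      rw [hsk, htl, hk]
      exact (log_add_eq_log (Nat.succ_ne_zero _) (by omega)).symm
    _ ≤ _ := Finset.card_image_le

/-! ### Infinite-dimensional targets -/

section Embedding

variable {𝕜 : Type*} [RCLike 𝕜] {Y : Type*} [NormedAddCommGroup Y] [NormedSpace 𝕜 Y]

/-- If the ball of radius `C` cannot be escaped in any number of moves, vectors of a basic sequence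
can be put on the vertices of the tree so that all sums over a block of a branch stay in the
ball. -/
theorem exists_isBasicSeq_norm_sum_block_le (hY : ¬ FiniteDimensional 𝕜 Y) {C : ℝ}
    (h : ∀ n, ¬ Escapes 𝕜 C n (0 : Y)) :
    ∃ x : ℕ → Y, IsBasicSeq 𝕜 x ∧
      ∀ t : Finset ℕ, t.Nonempty → ‖∑ s ∈ block t, x (code s)‖ ≤ C := by
  have := farSphere_neBot hY
  -- Within a block, the vectors answer the escaping player, with as many moves left as there
  -- are levels left.
  obtain ⟨x, hx, hxQ⟩ := exists_isBasicSeq (𝕜 := 𝕜)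
    (fun n (x : ℕ → Y) y => (code.symm n).Nonempty →
      ¬ Escapes 𝕜 C (levelsLeft (code.symm n).card)
        (∑ s ∈ (block (code.symm n)).erase (code.symm n), x (code s) + y))
    (fun n x x' y hxx hQ ht => by
      have : ∑ s ∈ (block (code.symm n)).erase (code.symm n), x' (code s)
          = ∑ s ∈ (block (code.symm n)).erase (code.symm n), x (code s) := by
        refine Finset.sum_congr rfl fun s hs => (hxx _ ?_).symm
        rw [Finset.mem_erase, mem_block] at hs
        simpa using code_lt_code hs.2.1 hs.1
      rw [this]
      exact hQ ht)
    (fun n x hx => by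
      refine Frequently.mono (frequently_not_escapes
        (u := ∑ s ∈ (block (code.symm n)).erase (code.symm n), x (code s)) ?_) fun y hy _ => hy
      rcases block_erase_self (code.symm n) with h0 | ⟨p, hp1, hp2, hp3, hp4⟩
      · rw [h0, Finset.sum_empty]
        exact h _
      · have hlt : code p < n := by simpa using code_lt_code hp1 hp2
        have hpne := (mem_pre.1 hp1).2.1
        have := hx (code p) hlt
        rw [Equiv.symm_apply_apply] at this
        rw [hp4, ← hp3, ← Finset.sum_erase_add _ _ (self_mem_block hpne)]
        exact this hpne)
  refine ⟨x, hx, fun t ht => ?_⟩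
  have := hxQ (code t)
  rw [Equiv.symm_apply_apply, Finset.sum_erase_add _ _ (self_mem_block ht)] at this
  exact norm_le_of_not_escapes (this ht)

/-- Lower bound for the differences of path sums of block sums: a vertex of one branch above the
common part has as coefficient the number of vertices of that branch in its block from it on. -/
theorem le_norm_sub_sum_block {x : ℕ → Y} (hx : IsBasicSeq 𝕜 x) (r : ℕ) (m n : Finset ℕ)
    (h : (commonInit m n).card + 2 * 2 ^ r ≤ m.card) :
    (2 ^ r : ℝ) ≤ 4 * ‖∑ t ∈ pre m, ∑ s ∈ block t, x (code s)
      - ∑ t ∈ pre n, ∑ s ∈ block t, x (code s)‖ := by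
  obtain ⟨s, hs, hs1, hs2⟩ := exists_le_card_filter_block r _ m h
  have hsn := notMem_pre_of_card_lt hs hs1
  let c : Finset ℕ → Finset ℕ → ℕ := fun m s => ((pre m).filter (s ∈ block ·)).card
  have hc0 : ∀ m s, s ∉ pre m → c m s = 0 := by
    intro m s hsm
    rw [Finset.card_eq_zero, Finset.filter_eq_empty_iff]
    exact fun t ht hst => hsm (pre_trans (mem_block.1 hst).1 ht)
  have hsum : ∀ (m : Finset ℕ) (F : Finset (Finset ℕ)), pre m ⊆ F →
      ∑ t ∈ pre m, ∑ s ∈ block t, x (code s) = ∑ s ∈ F, (c m s : 𝕜) • x (code s) := by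
    intro m F hF
    rw [Finset.sum_comm' (t' := F) (s' := fun s => (pre m).filter (s ∈ block ·))]
    · simp [c, Nat.cast_smul_eq_nsmul]
    · intro t s
      simp only [Finset.mem_filter]
      exact ⟨fun h => ⟨h, hF (pre_trans (mem_block.1 h.2).1 h.1)⟩, fun h => h.1⟩
  rw [hsum m (pre m ∪ pre n) Finset.subset_union_left,
    hsum n (pre m ∪ pre n) Finset.subset_union_right, ← Finset.sum_sub_distrib]
  simp only [← sub_smul]
  obtain ⟨N, hN, hNs⟩ := exists_sum_eq_sum_range x (pre m ∪ pre n)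
    (fun s => (c m s : 𝕜) - (c n s : 𝕜)) (fun s hs => by
      rw [Finset.mem_union, not_or] at hs
      simp [hc0 m s hs.1, hc0 n s hs.2])
  rw [hNs]
  refine le_trans ?_ (hx.norm_coeff_le _ (hN s (Finset.mem_union_left _ hs)))
  rw [Equiv.symm_apply_apply, hc0 n s hsn, Nat.cast_zero, sub_zero, RCLike.norm_natCast]
  exact_mod_cast hs2

/-- Summing the block sums along the path from the root is a coarse embedding if the block sums
are bounded. -/
theorem coarselyEmbeds_of_not_escapes (hY : ¬ FiniteDimensional 𝕜 Y) {C : ℝ}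
    (h : ∀ n, ¬ Escapes 𝕜 C n (0 : Y)) : CoarselyEmbeds TreeInf Y := by
  obtain ⟨x, hx, hxC⟩ := exists_isBasicSeq_norm_sum_block_le hY h
  refine ⟨fun m => ∑ t ∈ pre m.toFinset, ∑ s ∈ block t, x (code s),
    .of_bounds _ C (dist_sum_pre_le _ C hxC) fun R => ?_⟩
  obtain ⟨r, hr⟩ := pow_unbounded_of_one_lt (4 * R) (one_lt_two (α := ℝ))
  refine ⟨4 * 2 ^ r, fun m n hmn => ?_⟩
  change (4 * 2 ^ r : ℝ) ≤ (m.toFinset.card : ℝ) + (n.toFinset.card : ℝ)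
    - 2 * ((commonInit m.toFinset n.toFinset).card : ℝ) at hmn
  have hmn' : 4 * 2 ^ r + 2 * (commonInit m.toFinset n.toFinset).card
      ≤ m.toFinset.card + n.toFinset.card := by
    have : (4 * 2 ^ r + 2 * (commonInit m.toFinset n.toFinset).card : ℝ)
      ≤ m.toFinset.card + n.toFinset.card := by linarith
    exact_mod_cast this
  rcases le_total ((commonInit m.toFinset n.toFinset).card + 2 * 2 ^ r) m.toFinset.card
    with h1 | h1
  · have := le_norm_sub_sum_block hx r _ _ h1
    rw [dist_eq_norm]
    linarith
  · have := le_norm_sub_sum_block hx r n.toFinset m.toFinset (by rw [commonInit_comm]; omega)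
    rw [dist_comm, dist_eq_norm]
    linarith

/-- Summing the basis vectors along the path from the root is a coarse embedding if signed sums
are large. -/
theorem coarselyEmbeds_of_escapes (hY : ¬ FiniteDimensional 𝕜 Y)
    (h : ∀ C : ℝ, ∃ n, Escapes 𝕜 C n (0 : Y)) : CoarselyEmbeds TreeInf Y := by
  obtain ⟨x, hx, hxR⟩ := exists_isBasicSeq_norm_signed_sum hY h
  refine ⟨fun m => ∑ s ∈ pre m.toFinset, x (code s),
    .of_bounds _ 1 (dist_sum_pre_le (fun s => x (code s)) 1
      fun t _ => (hx.norm_eq_one _).le) fun R => ?_⟩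
  obtain ⟨D, hD⟩ := hxR R
  refine ⟨D, fun m n hmn => ?_⟩
  set P := pre m.toFinset
  set Q := pre n.toFinset
  let a : Finset ℕ → 𝕜 := fun s => (if s ∈ P then 1 else 0) - (if s ∈ Q then 1 else 0)
  have hsum : ∑ s ∈ P, x (code s) - ∑ s ∈ Q, x (code s) = ∑ s ∈ P ∪ Q, a s • x (code s) := by
    have h1 : ∀ F ⊆ P ∪ Q, ∑ s ∈ F, x (code s)
        = ∑ s ∈ P ∪ Q, (if s ∈ F then (1 : 𝕜) else 0) • x (code s) := by
      intro F hF
      simp only [ite_smul, one_smul, zero_smul]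
      rw [← Finset.sum_filter, Finset.filter_mem_eq_inter, Finset.inter_eq_right.2 hF]
    rw [h1 P Finset.subset_union_left, h1 Q Finset.subset_union_right, ← Finset.sum_sub_distrib]
    simp only [← sub_smul, a]
  obtain ⟨N, hN, hNs⟩ := exists_sum_eq_sum_range x (P ∪ Q) a (fun s hs => by
    rw [Finset.mem_union, not_or] at hs
    simp [a, hs.1, hs.2])
  rw [dist_eq_norm, hsum, hNs]
  have ha : ∀ s, a s = 0 ∨ a s = 1 ∨ a s = -1 := fun s => by
    by_cases h1 : s ∈ P <;> by_cases h2 : s ∈ Q <;> simp [a, h1, h2]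
  refine hD _ N (fun i => ha _) ?_
  have hdist : D ≤ (P \ Q).card + (Q \ P).card := by
    rw [dist_eq_card_sdiff] at hmn
    exact_mod_cast hmn
  rw [← Finset.card_union_of_disjoint disjoint_sdiff_sdiff] at hdist
  refine hdist.trans ?_
  rw [← Finset.card_image_of_injective _ code.injective]
  refine Finset.card_le_card fun i hi => ?_
  obtain ⟨s, hs, rfl⟩ := Finset.mem_image.1 hi
  rw [Finset.mem_filter, Finset.mem_range, Equiv.symm_apply_apply]
  rw [Finset.mem_union, Finset.mem_sdiff, Finset.mem_sdiff] at hs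
  rcases hs with ⟨h1, h2⟩ | ⟨h1, h2⟩
  · exact ⟨hN s (Finset.mem_union_left _ h1), by simp [a, h1, h2]⟩
  · exact ⟨hN s (Finset.mem_union_right _ h1), by simp [a, h1, h2]⟩

theorem coarselyEmbeds_of_infiniteDimensional (hY : ¬ FiniteDimensional 𝕜 Y) :
    CoarselyEmbeds TreeInf Y := by
  by_cases h : ∃ C : ℝ, ∀ n, ¬ Escapes 𝕜 C n (0 : Y)
  · obtain ⟨C, hC⟩ := h
    exact coarselyEmbeds_of_not_escapes hY hC
  · push Not at h
    exact coarselyEmbeds_of_escapes hY h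

end Embedding
end CoarseTree

theorem theoremE {𝕜 : Type*} [RCLike 𝕜] (Y : Type*) [NormedAddCommGroup Y] [NormedSpace 𝕜 Y]
    [CompleteSpace Y] :
    List.TFAE
      [FiniteDimensional 𝕜 Y,
        ¬ CoarseTree.EquiCoarselyEmbeds (fun k : ℕ+ => CoarseTree.TreeOfHeight (k : ℕ)) Y,
        ¬ CoarseTree.CoarselyEmbeds CoarseTree.TreeInf Y] := by
  tfae_have 1 → 2 := by
    intro h
    have := FiniteDimensional.proper 𝕜 Y
    exact CoarseTree.not_equiCoarselyEmbeds_of_properSpace Y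
  tfae_have 2 → 3 := fun h h' => h h'.equiCoarselyEmbeds
  tfae_have 3 → 1 := fun h => by
    by_contra hY
    exact h (CoarseTree.coarselyEmbeds_of_infiniteDimensional hY)
  tfae_finish
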